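/- Let $\ell,T,h,\theta>0$ and let $\rho_A,\mu,r,\kappa\in L^\infty(0,\ell)$ satisfy, for constants, $0<\rho_0\le\rho_A\le\rho_1$, $0\le\mu_0\le\mu\le\mu_1$, $0<r_0\le r\le r_1$, $0<\kappa_0\le\kappa\le\kappa_1$ almost everywhere on $(0,\ell)$. For $g\in H^1(0,T)$ with $g(0)=0$ consider on $(0,\ell)\times(0,T)$ the problem $$\rho_A(x)u_{tt}+\mu(x)u_t+(r(x)u_{xx}+\kappa(x)u_{xxt})_{xx}=0,\qquad u(x,0)=u_t(x,0)=0,\qquad u(0,t)=u_x(0,t)=0,$$ $$(r u_{xx}+\kappa u_{xxt})\big|_{x=\ell}=M(t):=\tfrac{2h\cos\theta}{\pi}\,g(t),\qquad -(r u_{xx}+\kappa u_{xxt})_x\big|_{x=\ell}=g(t).$$ Let $V=\{v\in H^2(0,\ell): v(0)=v'(0)=0\}$. A weak solution is a function $u\in L^2(0,T;V)$ with $u_t\in L^2(0,T;V)$ and $(\rho_A u_t)_t\in L^2(0,T;V^*)$, where $\rho_A u_t(t)\in V^*$ acts by $v\mapsto\int_0^\ell\rho_A u_t v\,dx$, such that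 $u(0)=0$ in $V$, $(\rho_A u_t)(0)=0$ in $V^*$, and for almost every $t\in(0,T)$ and all $v\in V$ $$\langle(\rho_A u_t)_t,v\rangle+\int_0^\ell\mu u_t v\,dx+\int_0^\ell(r u_{xx}+\kappa u_{xxt})v''\,dx=g(t)\,v(\ell)+M(t)\,v'(\ell).$$ Then for every $g\in H^1(0,T)$ with $g(0)=0$ there is exactly one weak solution $u(\cdot,\cdot\,;g)$, and its trace $u(\ell,\cdot\,;g)$ belongs to $L^2(0,T)$. The Neumann-to-Dirichlet operator $\Psi:g\mapsto u(\ell,\cdot\,;g)$ from $\{g\in H^1(0,T): g(0)=0\}$, with the $H^1(0,T)$ norm, to $L^2(0,T)$ is linear and compact. In particular, for every $C_g>0$ it maps the set of admissible shear forces $\mathcal G=\{g\in H^1(0,T): g(0)=0,\ \|g\|_{H^1(0,T)}\le C_g\}$ to a relatively compact subset of $L^2(0,T)$. -/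

import Mathlib

open Set MeasureTheory Filter
open scoped ContDiff

noncomputable section

/-- The real Hilbert space `L²(0,a)`. -/
abbrev L2 (a : ℝ) : Type := Lp ℝ 2 (volume.restrict (Ioo (0 : ℝ) a))

/-- `f'` is the weak derivative of `f` on `(0,a)`, tested against all `φ ∈ C_c^∞(0,a)`.
It is used for (Bochner) integrable functions with values in a Banach space `E`. -/
def IsWeakDeriv {E : Type*} [NormedAddCommGroup E] [NormedSpace ℝ E]
    (a : ℝ) (f f' : ℝ → E) : Prop :=
  ∀ φ : ℝ → ℝ, ContDiff ℝ ∞ φ → HasCompactSupport φ → tsupport φ ⊆ Ioo 0 a →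
    ∫ t in Ioo 0 a, deriv φ t • f t = -∫ t in Ioo 0 a, φ t • f' t

/-- The function `f`, given up to equality almost everywhere on `(0,a)`, has a representative that
is continuous on `[0,a]` and takes the value `c` at the point `x`. -/
def HasValueAt {E : Type*} [TopologicalSpace E] (a : ℝ) (f : ℝ → E) (x : ℝ) (c : E) : Prop :=
  ∃ F : ℝ → E, ContinuousOn F (Icc 0 a) ∧ f =ᵐ[volume.restrict (Ioo 0 a)] F ∧ F x = c

/-- The value at `x` of the continuous representative on `[0,a]` of `f`
(and `0` if there is no such representative; every function in `H¹(0,a)` has one). -/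
def valueAt (a : ℝ) (f : ℝ → ℝ) (x : ℝ) : ℝ :=
  open Classical in if h : ∃ c, HasValueAt a f x c then h.choose else 0

theorem HasValueAt.unique {E : Type*} [TopologicalSpace E] [T2Space E] {a x : ℝ} (ha : 0 < a)
    (hx : x ∈ Icc 0 a) {f : ℝ → E} {c d : E} (hc : HasValueAt a f x c) (hd : HasValueAt a f x d) :
    c = d := by
  obtain ⟨F, hF, hfF, rfl⟩ := hc
  obtain ⟨G, hG, hfG, rfl⟩ := hd
  have h : F =ᵐ[volume.restrict (Icc 0 a)] G := by
    rw [← restrict_Ioo_eq_restrict_Icc]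
    exact hfF.symm.trans hfG
  exact Measure.eqOn_Icc_of_ae_eq volume ha.ne h hF hG hx

theorem HasValueAt.valueAt_eq {a x c : ℝ} (ha : 0 < a) (hx : x ∈ Icc 0 a) {f : ℝ → ℝ}
    (hc : HasValueAt a f x c) : valueAt a f x = c := by
  have h : ∃ c, HasValueAt a f x c := ⟨c, hc⟩
  rw [valueAt, dif_pos h]
  exact h.choose_spec.unique ha hx hc

theorem L2.integrable {a : ℝ} (f : L2 a) : Integrable f (volume.restrict (Ioo 0 a)) :=
  (Lp.memLp f).integrable (by norm_num)

theorem L2.integrable_smul {a : ℝ} (f : L2 a) {φ : ℝ → ℝ} (hφ : Continuous φ)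
    (hc : HasCompactSupport φ) :
    Integrable (fun t => φ t • f t) (volume.restrict (Ioo 0 a)) := by
  obtain ⟨C, hC⟩ := hφ.bounded_above_of_compact_support hc
  exact (L2.integrable f).bdd_mul hφ.aestronglyMeasurable (Eventually.of_forall hC)

theorem IsWeakDeriv.congr_ae {a : ℝ} {f f' g g' : ℝ → ℝ} (h : IsWeakDeriv a f f')
    (hf : f =ᵐ[volume.restrict (Ioo 0 a)] g) (hf' : f' =ᵐ[volume.restrict (Ioo 0 a)] g') :
    IsWeakDeriv a g g' := by
  intro φ h1 h2 h3
  rw [← integral_congr_ae (hf.mono fun t ht => congrArg (fun y => deriv φ t • y) ht),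
    ← integral_congr_ae (hf'.mono fun t ht => congrArg (fun y => φ t • y) ht)]
  exact h φ h1 h2 h3

theorem IsWeakDeriv.zero (a : ℝ) : IsWeakDeriv a (0 : ℝ → ℝ) 0 := by
  intro φ _ _ _
  simp

theorem IsWeakDeriv.add_L2 {a : ℝ} {f f' g g' : L2 a} (hf : IsWeakDeriv a f f')
    (hg : IsWeakDeriv a g g') : IsWeakDeriv a ((f : ℝ → ℝ) + (g : ℝ → ℝ))
    ((f' : ℝ → ℝ) + (g' : ℝ → ℝ)) := by
  intro φ h1 h2 h3
  have hc' : Continuous (deriv φ) := h1.continuous_deriv (by simp)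
  simp only [Pi.add_apply, smul_add]
  rw [integral_add (L2.integrable_smul _ hc' h2.deriv) (L2.integrable_smul _ hc' h2.deriv),
    integral_add (L2.integrable_smul _ h1.continuous h2) (L2.integrable_smul _ h1.continuous h2),
    hf φ h1 h2 h3, hg φ h1 h2 h3]
  ring

theorem IsWeakDeriv.const_smul {a : ℝ} (c : ℝ) {f f' : ℝ → ℝ} (hf : IsWeakDeriv a f f') :
    IsWeakDeriv a (c • f) (c • f') := by
  intro φ h1 h2 h3
  simp only [Pi.smul_apply, smul_comm _ c]
  rw [integral_smul, integral_smul, hf φ h1 h2 h3, smul_neg]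

/-- The space `{v ∈ Hᵏ(0,a) : v(0) = v'(0) = ⋯ = v⁽ᵏ⁻¹⁾(0) = 0}` with the norm of `Hᵏ(0,a)`, the
square root of the sum of the squares of the `L²` norms of `v, v', …, v⁽ᵏ⁾`. An element is the
tuple `(v, v', …, v⁽ᵏ⁾)` of a function in `L²(0,a)` and its weak derivatives. -/
def sobolevLeft (k : ℕ) (a : ℝ) : Submodule ℝ (PiLp 2 (fun _ : Fin (k + 1) => L2 a)) where
  carrier := {p | ∀ i : Fin k,
    IsWeakDeriv a (p i.castSucc) (p i.succ) ∧ HasValueAt a (p i.castSucc) 0 0}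
  zero_mem' := by
    intro i
    have h0 : ((0 : L2 a) : ℝ → ℝ) =ᵐ[volume.restrict (Ioo 0 a)] 0 := Lp.coeFn_zero _ _ _
    exact ⟨(IsWeakDeriv.zero a).congr_ae h0.symm h0.symm, 0, continuousOn_const, h0, rfl⟩
  add_mem' := by
    intro p q hp hq i
    obtain ⟨hp1, F, hF, hpF, hF0⟩ := hp i
    obtain ⟨hq1, G, hG, hqG, hG0⟩ := hq i
    have hs := Lp.coeFn_add (p i.castSucc) (q i.castSucc)
    have hd := Lp.coeFn_add (p i.succ) (q i.succ)
    exact ⟨(hp1.add_L2 hq1).congr_ae hs.symm hd.symm, F + G, hF.add hG, hs.trans (hpF.add hqG),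
      by simp [hF0, hG0]⟩
  smul_mem' := by
    intro c p hp i
    obtain ⟨hp1, F, hF, hpF, hF0⟩ := hp i
    have hs := Lp.coeFn_smul c (p i.castSucc)
    have hd := Lp.coeFn_smul c (p i.succ)
    exact ⟨(hp1.const_smul c).congr_ae hs.symm hd.symm, c • F, hF.const_smul c,
      hs.trans (hpF.const_smul c), by simp [hF0]⟩

/-- `{g ∈ H¹(0,T) : g(0) = 0}`, the shear forces, with the `H¹(0,T)` norm. -/
abbrev ShearForce (T : ℝ) : Type := sobolevLeft 1 T

/-- The shear force as a function of time. -/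
def ShearForce.toFun {T : ℝ} (g : ShearForce T) : ℝ → ℝ := g.1 0

/-- The set of admissible shear forces `{g ∈ H¹(0,T) : g(0) = 0, ‖g‖_{H¹(0,T)} ≤ C}`. -/
def admissibleSet (T C : ℝ) : Set (ShearForce T) := {g | ‖g‖ ≤ C}

/-- `{v ∈ H²(0,ℓ) : v(0) = v'(0) = 0}`, the deflections of a beam clamped at the left end. -/
abbrev Deflection (ℓ : ℝ) : Type := sobolevLeft 2 ℓ

namespace Deflection

variable {ℓ : ℝ}

/-- The deflection as a function of `x`. -/
def toFun (v : Deflection ℓ) : ℝ → ℝ := v.1 0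

/-- The first derivative with respect to `x`. -/
def dx (v : Deflection ℓ) : ℝ → ℝ := v.1 1

/-- The second derivative with respect to `x`. -/
def dxx (v : Deflection ℓ) : ℝ → ℝ := v.1 2

/-- The deflection `v(ℓ)` at the tip. -/
def tip (v : Deflection ℓ) : ℝ := valueAt ℓ v.toFun ℓ

/-- The slope `v'(ℓ)` at the tip. -/
def tipSlope (v : Deflection ℓ) : ℝ := valueAt ℓ v.dx ℓ

end Deflection

/-- The data of the vibration model: length, final time, tip length, half-conic angle, mass per
unit length, external damping, flexural rigidity and Kelvin-Voigt damping. -/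
structure Beam where
  (ℓ T h θ : ℝ)
  (ρ μ r κ : ℝ → ℝ)

/-- The basic conditions: all four coefficients are in `L^∞(0,ℓ)`, `μ` is nonnegative and the others
are bounded below by positive constants. -/
structure Beam.BasicConditions (B : Beam) : Prop where
  ℓ_pos : 0 < B.ℓ
  T_pos : 0 < B.T
  h_pos : 0 < B.h
  θ_pos : 0 < B.θ
  ρ_meas : AEStronglyMeasurable B.ρ (volume.restrict (Ioo 0 B.ℓ))
  μ_meas : AEStronglyMeasurable B.μ (volume.restrict (Ioo 0 B.ℓ))
  r_meas : AEStronglyMeasurable B.r (volume.restrict (Ioo 0 B.ℓ))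
  κ_meas : AEStronglyMeasurable B.κ (volume.restrict (Ioo 0 B.ℓ))
  ρ_bounds : ∃ ρ₀ ρ₁ : ℝ, 0 < ρ₀ ∧ ∀ᵐ x ∂volume.restrict (Ioo 0 B.ℓ), ρ₀ ≤ B.ρ x ∧ B.ρ x ≤ ρ₁
  μ_bounds : ∃ μ₀ μ₁ : ℝ, 0 ≤ μ₀ ∧ ∀ᵐ x ∂volume.restrict (Ioo 0 B.ℓ), μ₀ ≤ B.μ x ∧ B.μ x ≤ μ₁
  r_bounds : ∃ r₀ r₁ : ℝ, 0 < r₀ ∧ ∀ᵐ x ∂volume.restrict (Ioo 0 B.ℓ), r₀ ≤ B.r x ∧ B.r x ≤ r₁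
  κ_bounds : ∃ κ₀ κ₁ : ℝ, 0 < κ₀ ∧ ∀ᵐ x ∂volume.restrict (Ioo 0 B.ℓ), κ₀ ≤ B.κ x ∧ B.κ x ≤ κ₁

/-- `u : t ↦ u(·,t)` is a weak solution on `(0,ℓ) × (0,T)` of
`ρ u_tt + μ u_t + (r u_xx + κ u_xxt)_xx = 0`, `u(x,0) = u_t(x,0) = 0`, `u(0,t) = u_x(0,t) = 0`,
`(r u_xx + κ u_xxt)(ℓ,t) = M(t)`, `-(r u_xx + κ u_xxt)_x(ℓ,t) = g(t)`, where
`M(t) = (2 h cos θ / π) g(t)`. Here `u` and `u_t` are in `L²(0,T;V)` and `(ρ u_t)_t` is in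
`L²(0,T;V*)` for `V = {v ∈ H²(0,ℓ) : v(0) = v'(0) = 0}`, whose members are the test functions.
The witnesses `w` and `z` are `u_t` and `(ρ u_t)_t`; the latter, as well as the initial condition
`u_t(·,0) = 0`, refers to `ρ u_t` as a function of time with values in `V*`. -/
def Beam.IsWeakSolution (B : Beam) (g : ℝ → ℝ) (u : ℝ → Deflection B.ℓ) : Prop :=
  MemLp u 2 (volume.restrict (Ioo 0 B.T)) ∧ HasValueAt B.T u 0 0 ∧
  ∃ (w : ℝ → Deflection B.ℓ) (z : ℝ → Deflection B.ℓ →L[ℝ] ℝ),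
    MemLp w 2 (volume.restrict (Ioo 0 B.T)) ∧ MemLp z 2 (volume.restrict (Ioo 0 B.T)) ∧
    IsWeakDeriv B.T (fun t => (u t).1) (fun t => (w t).1) ∧
    (∀ v : Deflection B.ℓ,
      IsWeakDeriv B.T (fun t => ∫ x in Ioo 0 B.ℓ, B.ρ x * (w t).toFun x * v.toFun x)
        (fun t => z t v) ∧
      HasValueAt B.T (fun t => ∫ x in Ioo 0 B.ℓ, B.ρ x * (w t).toFun x * v.toFun x) 0 0) ∧
    ∀ᵐ t ∂volume.restrict (Ioo 0 B.T), ∀ v : Deflection B.ℓ,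
      z t v + (∫ x in Ioo 0 B.ℓ, B.μ x * (w t).toFun x * v.toFun x)
        + (∫ x in Ioo 0 B.ℓ, (B.r x * (u t).dxx x + B.κ x * (w t).dxx x) * v.dxx x)
      = g t * v.tip + (2 * B.h * Real.cos B.θ / Real.pi * g t) * v.tipSlope

/-- `y` is the output `u(ℓ,·;g)` of a weak solution for the shear force `g`. -/
def Beam.IsOutput (B : Beam) (g : ShearForce B.T) (y : L2 B.T) : Prop :=
  ∃ u : ℝ → Deflection B.ℓ, B.IsWeakSolution g.toFun u ∧
    y =ᵐ[volume.restrict (Ioo 0 B.T)] fun t => (u t).tip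

/-- The Neumann-to-Dirichlet operator `Ψ : g ↦ u(ℓ,·;g)` with values in `L²(0,T)`
(with the value `0` should there be no solution with an output in `L²(0,T)`). -/
def Beam.neumannToDirichlet (B : Beam) (g : ShearForce B.T) : L2 B.T :=
  open Classical in if h : ∃ y, B.IsOutput g y then h.choose else 0

end

open scoped InnerProductSpace

noncomputable section

/-! Take the velocity `w = u_t` as the unknown and integrate the equation once in time. Let `J` be
the Volterra operator `f ↦ ∫₀ᵗ f`, and replace the forms by their Riesz operators on `V`. The weak
problem becomes a single identity in `L²(0,T;V)`, namely `M w + J D w = J (g L)`, where `D = C + R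
J` and `L` represents the load functional (`isWeakSolution_iff`).

Three facts make it solvable. First, `⟪M w, J w⟫` and `⟪R w, J w⟫` are nonnegative, since each is
half the quadratic form of `M` or `R` at `∫₀ᵀ w` (`inner_volterra_nonneg`). Second, `C` is coercive
by Kelvin-Voigt damping and the Poincaré inequality (`Deflection.norm_sq_le`). Third, `J` is
injective and commutes with operators acting pointwise in time. Uniqueness follows by pairing the
equation for a difference `d` of solutions with `J d`. Existence follows from an a priori estimate
for the adjoint problem and the Hahn-Banach theorem (`exists_solution`). Hence `g ↦ w` is bounded on
`L²`, without any Galerkin scheme.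

Compactness comes from the input: `g(0) = 0` gives `g = J g'`, so `Ψ` is `g ↦ g'`, then the scalar
Volterra operator, then a bounded operator. The scalar Volterra operator is a norm limit of
finite-rank operators (`isCompactOperator_volterra`). -/

/-- Lebesgue measure on the interval `(0,a)`. -/
abbrev leb (a : ℝ) : Measure ℝ := volume.restrict (Ioo (0 : ℝ) a)

/-! ### Weak derivatives and primitives -/

section Primitive

variable {E : Type*} [NormedAddCommGroup E] [NormedSpace ℝ E]
  {F : Type*} [NormedAddCommGroup F] [NormedSpace ℝ F]
  {G : Type*} [NormedAddCommGroup G] [NormedSpace ℝ G]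

/-- The primitive `t ↦ ∫₀ᵗ f` of a function on `(0,a)`. -/
def prim (a : ℝ) (f : ℝ → E) (t : ℝ) : E := ∫ s in Iic t, f s ∂leb a

theorem prim_congr {a : ℝ} {f g : ℝ → E} (h : f =ᵐ[leb a] g) : prim a f = prim a g := by
  funext t
  exact integral_congr_ae (ae_restrict_of_ae h)

theorem prim_zero_right (a : ℝ) (f : ℝ → E) : prim a f 0 = 0 := by
  rw [prim, Measure.restrict_restrict measurableSet_Iic,
    (Set.disjoint_left.2 fun x hx hx' => absurd hx'.1 (not_lt.2 hx) :
      Disjoint (Iic (0 : ℝ)) (Ioo 0 a)).inter_eq]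
  simp

theorem prim_sub {a : ℝ} {f : ℝ → E} (hf : Integrable f (leb a)) (s t : ℝ) :
    prim a f t - prim a f s = ∫ x in s..t, f x ∂leb a :=
  intervalIntegral.integral_Iic_sub_Iic hf.integrableOn hf.integrableOn

theorem continuous_prim {a : ℝ} {f : ℝ → E} (hf : Integrable f (leb a)) :
    Continuous (prim a f) := by
  have h : prim a f = fun t => ∫ x in (0 : ℝ)..t, f x ∂leb a := by
    funext t
    rw [← prim_sub hf, prim_zero_right, sub_zero]
  rw [h]
  exact intervalIntegral.continuous_primitive (fun _ _ => hf.intervalIntegrable) 0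

theorem hasValueAt_prim {a : ℝ} {f g : ℝ → E} (hg : Integrable g (leb a))
    (h : f =ᵐ[leb a] prim a g) (t : ℝ) : HasValueAt a f t (prim a g t) :=
  ⟨prim a g, (continuous_prim hg).continuousOn, h, rfl⟩

theorem prim_end {a : ℝ} (f : ℝ → E) : prim a f a = ∫ x, f x ∂leb a := by
  rw [prim, Measure.restrict_restrict measurableSet_Iic,
    inter_eq_right.2 (show Ioo 0 a ⊆ Iic a from fun x hx => hx.2.le)]

theorem map_prim [CompleteSpace E] [CompleteSpace F] (L : E →L[ℝ] F) {a : ℝ} {f : ℝ → E}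
    (hf : Integrable f (leb a)) (t : ℝ) : prim a (fun s => L (f s)) t = L (prim a f t) :=
  L.integral_comp_comm hf.integrableOn

/-- Fubini's theorem on the triangle `s ≤ t`. -/
theorem integral_bilin_prim [CompleteSpace E] [CompleteSpace F] [CompleteSpace G]
    (B : E →L[ℝ] F →L[ℝ] G) {a : ℝ} {p : ℝ → E} {q : ℝ → F} (hp : Integrable p (leb a))
    (hq : Integrable q (leb a)) :
    ∫ t, B (p t) (prim a q t) ∂leb a = ∫ s, B (∫ t in Ici s, p t ∂leb a) (q s) ∂leb a := by
  have hm : MeasurableSet {z : ℝ × ℝ | z.2 ≤ z.1} := measurableSet_le measurable_snd measurable_fst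
  have hi : Integrable (Function.uncurry fun t s =>
      {z : ℝ × ℝ | z.2 ≤ z.1}.indicator (fun z => B (p z.1) (q z.2)) (t, s))
      ((leb a).prod (leb a)) :=
    (hp.op_fst_snd (op := fun x y => B x y) (by fun_prop) ⟨‖B‖, B.le_opNorm₂⟩ hq).indicator hm
  have h1 : ∀ t, B (p t) (prim a q t) = ∫ s,
      {z : ℝ × ℝ | z.2 ≤ z.1}.indicator (fun z => B (p z.1) (q z.2)) (t, s) ∂leb a := by
    intro t
    rw [prim, ← (B (p t)).integral_comp_comm hq.integrableOn, ← integral_indicator measurableSet_Iic]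
    rfl
  have h2 : ∀ s, B (∫ t in Ici s, p t ∂leb a) (q s) = ∫ t,
      {z : ℝ × ℝ | z.2 ≤ z.1}.indicator (fun z => B (p z.1) (q z.2)) (t, s) ∂leb a := by
    intro s
    change B.flip (q s) _ = _
    rw [← (B.flip (q s)).integral_comp_comm hp.integrableOn, ← integral_indicator measurableSet_Ici]
    rfl
  simp_rw [h1, h2]
  exact integral_integral_swap hi

theorem integrable_smul_of_test {a : ℝ} {f : ℝ → E} (hf : Integrable f (leb a)) {φ : ℝ → ℝ}
    (hφ : Continuous φ) (hc : HasCompactSupport φ) :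
    Integrable (fun t => φ t • f t) (leb a) := by
  obtain ⟨C, hC⟩ := hφ.bounded_above_of_compact_support hc
  exact hf.bdd_smul C hφ.aestronglyMeasurable (Eventually.of_forall hC)

/-- Fubini on the triangle moves the primitive onto the test function, and the inner integral `∫ₛᵃ
φ'` equals `-φ s` because `φ a = 0`. -/
theorem isWeakDeriv_prim [CompleteSpace E] {a : ℝ} {f g : ℝ → E} (hg : Integrable g (leb a))
    (h : f =ᵐ[leb a] prim a g) : IsWeakDeriv a f g := by
  intro φ h1 h2 h3
  have hc' : Continuous (deriv φ) := h1.continuous_deriv (by simp)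
  have hd : Integrable (deriv φ) (leb a) :=
    (hc'.integrable_of_hasCompactSupport h2.deriv).restrict
  rw [integral_congr_ae (g := fun t => deriv φ t • prim a g t)
    (h.mono fun t ht => congrArg (fun y => deriv φ t • y) ht)]
  have := integral_bilin_prim (ContinuousLinearMap.lsmul ℝ ℝ : ℝ →L[ℝ] E →L[ℝ] E) hd hg
  simp only [ContinuousLinearMap.lsmul_apply] at this
  rw [this, ← integral_neg]
  refine setIntegral_congr_fun measurableSet_Ioo fun s hs => ?_
  have ha : φ a = 0 := by
    by_contra hne
    exact absurd (h3 (subset_tsupport _ hne)).2 (lt_irrefl _)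
  have : ∫ t in Ici s, deriv φ t ∂leb a = -φ s := by
    rw [Measure.restrict_restrict measurableSet_Ici,
      (by ext x; simp only [mem_inter_iff, mem_Ici, mem_Ioo, mem_Ico]
          exact ⟨fun h => ⟨h.1, h.2.2⟩, fun h => ⟨h.1, hs.1.trans_le h.1, h.2⟩⟩ :
        Ici s ∩ Ioo 0 a = Ico s a), integral_Ico_eq_integral_Ioc,
      ← intervalIntegral.integral_of_le hs.2.le, intervalIntegral.integral_deriv_eq_sub
        (fun x _ => (h1.differentiable (by simp)).differentiableAt) (hc'.intervalIntegrable _ _),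
      ha, zero_sub]
  simp only [this, neg_smul]

/-- A smooth function of mean zero with compact support in `(0,a)` is the derivative of another
test function. -/
theorem exists_test_deriv_eq {a : ℝ} {ψ : ℝ → ℝ} (h1 : ContDiff ℝ ∞ ψ)
    (h2 : HasCompactSupport ψ) (h3 : tsupport ψ ⊆ Ioo 0 a) (h0 : ∫ t, ψ t = 0) :
    ∃ Φ : ℝ → ℝ, ContDiff ℝ ∞ Φ ∧ HasCompactSupport Φ ∧ tsupport Φ ⊆ Ioo 0 a ∧ deriv Φ = ψ := by
  have hd : ∀ t, HasDerivAt (fun t => ∫ s in (0 : ℝ)..t, ψ s) (ψ t) t := fun t =>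
    intervalIntegral.integral_hasDerivAt_right (h1.continuous.intervalIntegrable _ _)
      (h1.continuous.stronglyMeasurableAtFilter _ _) h1.continuous.continuousAt
  have hd' : deriv (fun t => ∫ s in (0 : ℝ)..t, ψ s) = ψ := funext fun t => (hd t).deriv
  -- The alternative `d < c` covers an empty support, where `Icc c d` is empty.
  obtain ⟨c, d, hc, hcd, hd0⟩ : ∃ c d, 0 < c ∧ tsupport ψ ⊆ Icc c d ∧ (d < a ∨ d < c) := by
    rcases (tsupport ψ).eq_empty_or_nonempty with he | hne
    · exact ⟨1, 0, one_pos, by simp [he], Or.inr one_pos⟩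
    · obtain ⟨c, hcm, hc⟩ := h2.isCompact.exists_isLeast hne
      obtain ⟨d, hdm, hd⟩ := h2.isCompact.exists_isGreatest hne
      exact ⟨c, d, (h3 hcm).1, fun x hx => ⟨hc hx, hd hx⟩, Or.inl (h3 hdm).2⟩
  have hz : ∀ s, s ∉ Icc c d → ψ s = 0 := fun s hs => by
    by_contra hne
    exact hs (hcd (subset_tsupport _ hne))
  have hsupp : tsupport (fun t => ∫ s in (0 : ℝ)..t, ψ s) ⊆ Icc c d := by
    refine closure_minimal ?_ isClosed_Icc
    intro t ht
    by_contra hn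
    apply ht
    by_cases htc : t < c
    · refine (intervalIntegral.integral_congr (g := fun _ => 0) fun s hs => hz s ?_).trans (by simp)
      intro hs'
      have : s ≤ max 0 t := by
        rw [mem_uIcc] at hs
        rcases hs with hs | hs <;> simp [hs.2]
      exact absurd (hs'.1.trans this) (not_le.2 (max_lt hc htc))
    · have htd : d < t := by
        by_contra h
        exact hn ⟨not_lt.1 htc, not_lt.1 h⟩
      have h0t : 0 ≤ t := hc.le.trans (not_lt.1 htc)
      change ∫ s in (0 : ℝ)..t, ψ s = 0
      rw [intervalIntegral.integral_of_le h0t]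
      refine Eq.trans ?_ h0
      refine setIntegral_eq_integral_of_forall_compl_eq_zero fun s hs => hz s fun hs' => hs ?_
      exact ⟨hc.trans_le hs'.1, hs'.2.trans htd.le⟩
  refine ⟨fun t => ∫ s in (0 : ℝ)..t, ψ s, ?_, isCompact_Icc.of_isClosed_subset
    (isClosed_tsupport _) hsupp, ?_, hd'⟩
  · rw [contDiff_infty_iff_deriv, hd']
    exact ⟨fun t => (hd t).differentiableAt, h1⟩
  · rcases hd0 with h | h
    · exact hsupp.trans fun x hx => ⟨hc.trans_le hx.1, hx.2.trans_lt h⟩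
    · rw [Icc_eq_empty (not_le.2 h)] at hsupp
      exact hsupp.trans (empty_subset _)

/-- The lemma of du Bois-Reymond. -/
theorem ae_eq_const_of_isWeakDeriv_zero [CompleteSpace E] {a : ℝ} (ha : 0 < a) {f : ℝ → E}
    (hf : Integrable f (leb a)) (h : IsWeakDeriv a f 0) : ∃ c : E, f =ᵐ[leb a] fun _ => c := by
  obtain ⟨η, hη1, hη2, hη3, hη4⟩ : ∃ η : ℝ → ℝ, ContDiff ℝ ∞ η ∧ HasCompactSupport η ∧
      tsupport η ⊆ Ioo 0 a ∧ ∫ t, η t = 1 := by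
    let b : ContDiffBump (a / 2) := ⟨a / 8, a / 4, by positivity, by linarith⟩
    refine ⟨b.normed volume, b.contDiff_normed, b.hasCompactSupport_normed, ?_, b.integral_normed⟩
    rw [b.tsupport_normed_eq]
    intro x hx
    rw [Metric.mem_closedBall, Real.dist_eq, abs_le] at hx
    change -(a / 4) ≤ _ ∧ _ ≤ a / 4 at hx
    constructor <;> linarith [hx.1, hx.2]
  refine ⟨∫ t, η t • f t ∂leb a, ?_⟩
  have key := isOpen_Ioo.ae_eq_zero_of_integral_contDiff_smul_eq_zero (μ := volume)
    (U := Ioo (0 : ℝ) a) (f := fun t => f t - ∫ t, η t • f t ∂leb a)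
    (IntegrableOn.locallyIntegrableOn (Integrable.sub hf (integrable_const _))) ?_
  · rw [Filter.EventuallyEq, ae_restrict_iff' measurableSet_Ioo]
    exact key.mono fun t ht hta => sub_eq_zero.1 (ht hta)
  intro φ h1 h2 h3
  have hφi : Integrable φ := h1.continuous.integrable_of_hasCompactSupport h2
  -- Subtracting `(∫ φ) • η` gives `φ` mean zero, hence makes it the derivative of an admissible
  -- test function.
  have hηi : Integrable η := hη1.continuous.integrable_of_hasCompactSupport hη2
  obtain ⟨Φ, hΦ1, hΦ2, hΦ3, hΦ⟩ := exists_test_deriv_eq (a := a) (ψ := φ - (∫ t, φ t) • η)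
    (h1.sub (contDiff_const.smul hη1)) (h2.sub (hη2.smul_left (f := fun _ => ∫ t, φ t)))
    ((tsupport_sub _ _).trans (union_subset h3 ((closure_mono
      (Function.support_const_smul_subset _ _)).trans hη3))) (by
      simp only [Pi.sub_apply, Pi.smul_apply, smul_eq_mul]
      rw [integral_sub hφi (hηi.const_mul _), integral_const_mul, hη4, mul_one, sub_self])
  have := h Φ hΦ1 hΦ2 hΦ3
  simp only [hΦ, Pi.sub_apply, Pi.smul_apply, smul_eq_mul, Pi.zero_apply, smul_zero, integral_zero,
    neg_zero, sub_smul, mul_smul] at this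
  have hφf := integrable_smul_of_test hf h1.continuous h2
  have hηf := integrable_smul_of_test hf hη1.continuous hη2
  rw [integral_sub hφf (show Integrable (fun t => (∫ t, φ t) • η t • f t) (leb a) from hηf.smul _),
    integral_smul] at this
  have hs : ∫ t, φ t • (f t - ∫ t, η t • f t ∂leb a)
      = ∫ t, φ t • (f t - ∫ t, η t • f t ∂leb a) ∂leb a := by
    refine (setIntegral_eq_integral_of_forall_compl_eq_zero fun t ht => ?_).symm
    rw [image_eq_zero_of_notMem_tsupport fun h => ht (h3 h), zero_smul]
  have hφs : ∫ t, φ t ∂leb a = ∫ t, φ t :=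
    setIntegral_eq_integral_of_forall_compl_eq_zero fun t ht =>
      image_eq_zero_of_notMem_tsupport fun h => ht (h3 h)
  rw [hs]
  simp only [smul_sub]
  rw [integral_sub hφf (hφi.restrict.smul_const _), integral_smul_const, hφs]
  exact this

/-- A function with an integrable weak derivative that vanishes at the left end is the primitive of
that derivative. -/
theorem IsWeakDeriv.ae_eq_prim [CompleteSpace E] {a : ℝ} (ha : 0 < a) {f g : ℝ → E}
    (hf : Integrable f (leb a)) (hg : Integrable g (leb a)) (h : IsWeakDeriv a f g)
    (h0 : HasValueAt a f 0 0) : f =ᵐ[leb a] prim a g := by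
  have hp : Integrable (prim a g) (leb a) :=
    ((continuous_prim hg).integrableOn_Icc (a := 0) (b := a)).mono_set Ioo_subset_Icc_self
  obtain ⟨c, hc⟩ := ae_eq_const_of_isWeakDeriv_zero ha (f := f - prim a g) (hf.sub hp) (by
    intro φ h1 h2 h3
    have hc' : Continuous (deriv φ) := h1.continuous_deriv (by simp)
    simp only [Pi.sub_apply, smul_sub, Pi.zero_apply, smul_zero, integral_zero, neg_zero]
    rw [integral_sub (integrable_smul_of_test hf hc' h2.deriv)
      (integrable_smul_of_test hp hc' h2.deriv), h φ h1 h2 h3,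
      isWeakDeriv_prim hg (ae_eq_refl _) φ h1 h2 h3, sub_self])
  -- Equality of weak derivatives determines `f` up to a constant; the initial value removes it.
  have hc0 : c = 0 := by
    have h1 : HasValueAt a f 0 (c + prim a g 0) :=
      ⟨fun t => c + prim a g t, (continuous_const.add (continuous_prim hg)).continuousOn,
        hc.mono fun t ht => sub_eq_iff_eq_add.1 ht, rfl⟩
    have := h1.unique ha ⟨le_rfl, ha.le⟩ h0
    rwa [prim_zero_right, add_zero] at this
  exact hc.mono fun t ht => sub_eq_zero.1 (ht.trans hc0)

end Primitive

/-! ### The Volterra operator on `L²(0,a;E)` -/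

section Volterra

variable {E : Type*} [NormedAddCommGroup E] [NormedSpace ℝ E]
  {F : Type*} [NormedAddCommGroup F] [NormedSpace ℝ F]

theorem Lp.integrable_leb {E : Type*} [NormedAddCommGroup E] {a : ℝ} (f : Lp E 2 (leb a)) : Integrable f (leb a) :=
  (Lp.memLp f).integrable (by norm_num)

/-- Cauchy-Schwarz against the indicator of `s`. It serves twice: for the boundedness of the
Volterra operator and for the Hölder modulus behind its compactness. -/
theorem norm_setIntegral_le_sqrt_mul {α : Type*} [MeasurableSpace α] {μ : Measure α}
    [IsFiniteMeasure μ] (f : Lp E 2 μ) {s : Set α} (hs : MeasurableSet s) :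
    ‖∫ x in s, f x ∂μ‖ ≤ √(μ.real s) * ‖f‖ := by
  refine (norm_integral_le_integral_norm _).trans ?_
  have hf := (Lp.memLp f).norm
  have h1 : ∫ x in s, ‖f x‖ ∂μ
      = ⟪indicatorConstLp 2 hs (measure_ne_top μ s) (1 : ℝ), hf.toLp _⟫_ℝ := by
    rw [L2.inner_indicatorConstLp_one]
    exact integral_congr_ae (ae_restrict_of_ae hf.coeFn_toLp.symm)
  rw [h1]
  refine (real_inner_le_norm _ _).trans_eq ?_
  rw [norm_indicatorConstLp (by norm_num) (by norm_num), Lp.norm_toLp, eLpNorm_norm, Lp.norm_def,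
    norm_one, one_mul]
  congr 1
  rw [Real.sqrt_eq_rpow]
  norm_num

theorem norm_prim_le {a : ℝ} (f : Lp E 2 (leb a)) (t : ℝ) :
    ‖prim a f t‖ ≤ √((leb a).real univ) * ‖f‖ :=
  (norm_setIntegral_le_sqrt_mul f measurableSet_Iic).trans
    (mul_le_mul_of_nonneg_right (Real.sqrt_le_sqrt (measureReal_mono (subset_univ _)))
      (norm_nonneg _))

theorem memLp_prim {a : ℝ} (f : Lp E 2 (leb a)) : MemLp (prim a f) 2 (leb a) :=
  MemLp.of_bound (continuous_prim (Lp.integrable_leb f)).aestronglyMeasurable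
    _ (Eventually.of_forall (norm_prim_le f))

theorem prim_add {a : ℝ} (f g : Lp E 2 (leb a)) (t : ℝ) :
    prim a (f + g : Lp E 2 (leb a)) t = prim a f t + prim a g t := by
  rw [prim_congr (Lp.coeFn_add f g)]
  exact integral_add (Lp.integrable_leb f).integrableOn (Lp.integrable_leb g).integrableOn

theorem prim_smul {a : ℝ} (c : ℝ) (f : Lp E 2 (leb a)) (t : ℝ) :
    prim a (c • f : Lp E 2 (leb a)) t = c • prim a f t := by
  rw [prim_congr (Lp.coeFn_smul c f)]
  exact integral_smul c _

variable (E) in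
/-- The Volterra operator `f ↦ ∫₀ᵗ f` on `L²(0,a;E)`. -/
def volterra (a : ℝ) : Lp E 2 (leb a) →L[ℝ] Lp E 2 (leb a) :=
  LinearMap.mkContinuous
    { toFun := fun f => (memLp_prim f).toLp _
      map_add' := fun f g => by
        rw [← MemLp.toLp_add]
        exact MemLp.toLp_congr _ _ (Eventually.of_forall (prim_add f g))
      map_smul' := fun c f => by
        rw [RingHom.id_apply, ← MemLp.toLp_const_smul]
        exact MemLp.toLp_congr _ _ (Eventually.of_forall (prim_smul c f)) }
    ((measureUnivNNReal (leb a) : ℝ) ^ (2 : ENNReal).toReal⁻¹ * √((leb a).real univ))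
    (fun f => by
      rw [mul_assoc]
      refine Lp.norm_le_of_ae_bound (by positivity) ?_
      exact (memLp_prim f).coeFn_toLp.mono fun t ht => ht ▸ norm_prim_le f t)

theorem coeFn_volterra {a : ℝ} (f : Lp E 2 (leb a)) : volterra E a f =ᵐ[leb a] prim a f :=
  (memLp_prim f).coeFn_toLp

/-- Integration in time commutes with any bounded operator applied at each time separately. -/
theorem volterra_compLpL [CompleteSpace E] [CompleteSpace F] {a : ℝ} (L : E →L[ℝ] F)
    (f : Lp E 2 (leb a)) :
    volterra F a (L.compLpL 2 (leb a) f) = L.compLpL 2 (leb a) (volterra E a f) := by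
  refine Lp.ext ?_
  filter_upwards [coeFn_volterra (L.compLpL 2 (leb a) f), L.coeFn_compLpL (volterra E a f),
    coeFn_volterra f] with t h1 h2 h3
  rw [h1, h2, h3, prim_congr (L.coeFn_compLpL f), map_prim L (Lp.integrable_leb f)]

/-- If the primitive vanishes, then `f` is a weak derivative of zero, and the fundamental lemma of
the calculus of variations gives `f = 0`. -/
theorem volterra_injective [CompleteSpace E] {a : ℝ} : Function.Injective (volterra E a) := by
  rw [injective_iff_map_eq_zero]
  intro f hf
  have h0 : (0 : ℝ → E) =ᵐ[leb a] prim a f := by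
    have := coeFn_volterra f
    rw [hf] at this
    exact (Lp.coeFn_zero _ _ _).symm.trans this
  have hw := isWeakDeriv_prim (Lp.integrable_leb f) h0
  have key := isOpen_Ioo.ae_eq_zero_of_integral_contDiff_smul_eq_zero (μ := volume)
    (U := Ioo (0 : ℝ) a) (f := f)
    (IntegrableOn.locallyIntegrableOn (Lp.integrable_leb f)) (fun φ h1 h2 h3 => by
      have := hw φ h1 h2 h3
      simp only [Pi.zero_apply, smul_zero, integral_zero, zero_eq_neg] at this
      rw [← this]
      refine (setIntegral_eq_integral_of_forall_compl_eq_zero fun t ht => ?_).symm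
      rw [image_eq_zero_of_notMem_tsupport fun h => ht (h3 h), zero_smul])
  refine Lp.ext (EventuallyEq.trans ?_ (Lp.coeFn_zero _ _ _).symm)
  rw [Filter.EventuallyEq, ae_restrict_iff' measurableSet_Ioo]
  exact key

/-- The quadratic form `f ↦ ∫₀ᵃ ⟪S f, ∫₀ᵗ f⟫` is nonnegative if `S` is symmetric and positive. -/
theorem inner_volterra_nonneg {V : Type*} [NormedAddCommGroup V] [InnerProductSpace ℝ V]
    [CompleteSpace V] (S : V →L[ℝ] V) (hS : ∀ x y, ⟪S x, y⟫_ℝ = ⟪x, S y⟫_ℝ)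
    (hS0 : ∀ x, 0 ≤ ⟪S x, x⟫_ℝ) {a : ℝ} (f : Lp V 2 (leb a)) :
    0 ≤ ⟪S.compLpL 2 (leb a) f, volterra V a f⟫_ℝ := by
  have hf := Lp.integrable_leb f
  have h1 : ⟪S.compLpL 2 (leb a) f, volterra V a f⟫_ℝ = ∫ t, ⟪S (f t), prim a f t⟫_ℝ ∂leb a := by
    rw [L2.inner_def]
    refine integral_congr_ae ?_
    filter_upwards [coeFn_volterra f, S.coeFn_compLpL f] with t h1 h2
    rw [h1, h2]
  have hint : Integrable (fun t => ⟪S (f t), prim a f t⟫_ℝ) (leb a) := by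
    refine (L2.integrable_inner (𝕜 := ℝ) (S.compLpL 2 (leb a) f) (volterra V a f)).congr ?_
    filter_upwards [coeFn_volterra f, S.coeFn_compLpL f] with t h1 h2
    rw [h1, h2]
  have h2 := integral_bilin_prim ((innerSL ℝ).comp S) hf hf
  simp only [ContinuousLinearMap.comp_apply, innerSL_apply_apply] at h2
  -- The tail integral is the total minus the primitive, so by symmetry of `S` Fubini returns the
  -- same form with opposite sign: twice the form equals `⟪S F, F⟫` with `F = ∫ f`.
  have h3 : ∀ s, ⟪S (∫ t in Ici s, f t ∂leb a), f s⟫_ℝ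
      = ⟪S (∫ t, f t ∂leb a), f s⟫_ℝ - ⟪S (f s), prim a f s⟫_ℝ := by
    intro s
    have : ∫ t in Ici s, f t ∂leb a = (∫ t, f t ∂leb a) - prim a f s := by
      rw [eq_sub_iff_add_eq', prim, integral_Ici_eq_integral_Ioi]
      exact intervalIntegral.integral_Iic_add_Ioi hf.integrableOn hf.integrableOn
    rw [this, map_sub, inner_sub_left, hS (prim a f s), real_inner_comm]
    simp only [real_inner_comm]
  have h4 : ∫ s, ⟪S (∫ t, f t ∂leb a), f s⟫_ℝ ∂leb a
      = ⟪S (∫ t, f t ∂leb a), ∫ t, f t ∂leb a⟫_ℝ := integral_inner hf _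
  simp_rw [h3] at h2
  rw [integral_sub (hf.const_inner _) hint, h4] at h2
  rw [h1]
  linarith [hS0 (∫ t, f t ∂leb a)]

end Volterra

/-! ### An abstract linear equation in Hilbert space -/

section Abstract

/-- If `⟪Dx,x⟫ ≥ β‖x‖²`, `⟪Mx,Jx⟫ ≥ 0` and `J` commutes with the symmetric operator `M`, then the
equation `M w + J D w = J G` has a solution with `‖w‖ ≤ β⁻¹‖G‖`. -/
theorem exists_solution {X : Type*} [NormedAddCommGroup X] [InnerProductSpace ℝ X]
    [CompleteSpace X] {M D J : X →L[ℝ] X} {β : ℝ} (hβ : 0 < β)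
    (hMs : ∀ x y, ⟪M x, y⟫_ℝ = ⟪x, M y⟫_ℝ) (hJM : ∀ x, J (M x) = M (J x))
    (hM : ∀ x, 0 ≤ ⟪M x, J x⟫_ℝ) (hD : ∀ x, β * ‖x‖ ^ 2 ≤ ⟪D x, x⟫_ℝ) (G : X) :
    ∃ w, M w + J (D w) = J G ∧ ‖w‖ ≤ β⁻¹ * ‖G‖ := by
  let N : X →L[ℝ] X := (M + J ∘L D).adjoint
  have hN : ∀ x y, ⟪N x, y⟫_ℝ = ⟪x, M y + J (D y)⟫_ℝ := fun x y =>
    ContinuousLinearMap.adjoint_inner_left _ _ _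
  -- A priori estimate for the adjoint: test `N x` with `J* x`. The `M` part becomes `⟪M x, J x⟫ ≥
  -- 0` by commutation, and the `D` part is coercive in `J* x`.
  have hb : ∀ x, ‖J.adjoint x‖ ≤ β⁻¹ * ‖N x‖ := by
    intro x
    have h1 : ⟪N x, J.adjoint x⟫_ℝ = ⟪M x, J x⟫_ℝ + ⟪D (J.adjoint x), J.adjoint x⟫_ℝ := by
      rw [hN, inner_add_right, ← ContinuousLinearMap.adjoint_inner_left J,
        real_inner_comm (D _)]
      congr 1
      rw [← hMs, real_inner_comm, ContinuousLinearMap.adjoint_inner_left, hJM, hMs, real_inner_comm]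
    have h2 := (real_inner_le_norm (N x) (J.adjoint x))
    rw [le_inv_mul_iff₀ hβ]
    rcases (norm_nonneg (J.adjoint x)).eq_or_lt with h0 | h0
    · rw [← h0, mul_zero]; exact norm_nonneg _
    · refine le_of_mul_le_mul_right ?_ h0
      nlinarith [hM x, hD (J.adjoint x)]
  obtain ⟨s, hs⟩ := LinearMap.exists_rightInverse_of_surjective N.toLinearMap.rangeRestrict
    (LinearMap.range_rangeRestrict _)
  have hNs : ∀ y, N (s y) = y := fun y => congrArg Subtype.val (LinearMap.congr_fun hs y)
  -- This is the functional `N x ↦ ⟪G, J* x⟫`. By `hb` it is bounded on the range of `N` and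
  -- independent of the preimage; a vector representing its extension solves the equation.
  let f : StrongDual ℝ N.toLinearMap.range := LinearMap.mkContinuous
    ((innerSL ℝ G).toLinearMap ∘ₗ J.adjoint.toLinearMap ∘ₗ s) (β⁻¹ * ‖G‖) (fun y => by
      refine (norm_inner_le_norm G (J.adjoint (s y))).trans ?_
      calc ‖G‖ * ‖J.adjoint (s y)‖ ≤ ‖G‖ * (β⁻¹ * ‖N (s y)‖) := by gcongr; exact hb _
        _ = β⁻¹ * ‖G‖ * ‖y‖ := by rw [hNs, Submodule.coe_norm]; ring)
  have hf : ∀ x, f ⟨N x, x, rfl⟩ = ⟪G, J.adjoint x⟫_ℝ := by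
    intro x
    have h := hb (s ⟨N x, x, rfl⟩ - x)
    rw [map_sub, map_sub, hNs, sub_self, norm_zero, mul_zero, norm_le_zero_iff, sub_eq_zero] at h
    exact congrArg (fun y => ⟪G, y⟫_ℝ) h
  obtain ⟨g, hg, hgn⟩ := exists_extension_norm_eq _ f
  refine ⟨(InnerProductSpace.toDual ℝ X).symm g, ?_, ?_⟩
  · refine ext_inner_left ℝ fun x => ?_
    rw [← hN, real_inner_comm, InnerProductSpace.toDual_symm_apply]
    rw [← ContinuousLinearMap.adjoint_inner_left J, real_inner_comm, ← hf]
    exact hg ⟨N x, x, rfl⟩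
  · rw [LinearIsometryEquiv.norm_map, hgn]
    exact LinearMap.mkContinuous_norm_le _ (by positivity) _

/-- The difference `d` satisfies `M d + D (J d) = 0`; pairing with `J d` and using coercivity gives
`J d = 0`. -/
theorem solution_unique {X : Type*} [NormedAddCommGroup X] [InnerProductSpace ℝ X]
    {M D J : X →L[ℝ] X} {β : ℝ} (hβ : 0 < β) (hJD : ∀ x, J (D x) = D (J x))
    (hJ : Function.Injective J)
    (hM : ∀ x, 0 ≤ ⟪M x, J x⟫_ℝ) (hD : ∀ x, β * ‖x‖ ^ 2 ≤ ⟪D x, x⟫_ℝ) {w w' : X}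
    (h : M w + J (D w) = M w' + J (D w')) : w = w' := by
  rw [← sub_eq_zero]
  have h0 : M (w - w') + D (J (w - w')) = 0 := by
    rw [← hJD]
    simp only [map_sub]
    rw [← sub_eq_zero] at h
    rw [← h]
    abel
  have h1 := congrArg (fun y => ⟪y, J (w - w')⟫_ℝ) h0
  simp only [inner_add_left, inner_zero_left] at h1
  have h2 : β * ‖J (w - w')‖ ^ 2 ≤ 0 := by linarith [hM (w - w'), hD (J (w - w'))]
  have h3 : J (w - w') = 0 := by
    by_contra hne
    have := norm_pos_iff.2 hne
    exact absurd h2 (not_le.2 (by positivity))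
  exact hJ (h3.trans (map_zero J).symm)

/-- The equation `M w + J D w = J G` defines a bounded linear operator `G ↦ w`. -/
theorem exists_solution_operator {X : Type*} [NormedAddCommGroup X] [InnerProductSpace ℝ X]
    [CompleteSpace X] {M D J : X →L[ℝ] X} {β : ℝ} (hβ : 0 < β)
    (hMs : ∀ x y, ⟪M x, y⟫_ℝ = ⟪x, M y⟫_ℝ) (hJM : ∀ x, J (M x) = M (J x))
    (hJD : ∀ x, J (D x) = D (J x)) (hJ : Function.Injective J)
    (hM : ∀ x, 0 ≤ ⟪M x, J x⟫_ℝ) (hD : ∀ x, β * ‖x‖ ^ 2 ≤ ⟪D x, x⟫_ℝ) :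
    ∃ S : X →L[ℝ] X, ∀ G w, M w + J (D w) = J G ↔ w = S G := by
  choose S hS hSn using exists_solution hβ hMs hJM hM hD
  have hu : ∀ G w, M w + J (D w) = J G ↔ w = S G := fun G w =>
    ⟨fun h => solution_unique hβ hJD hJ hM hD (h.trans (hS G).symm), fun h => h ▸ hS G⟩
  -- Uniqueness makes the chosen solutions linear in `G`.
  refine ⟨LinearMap.mkContinuous
    { toFun := S
      map_add' := fun G G' => ?_
      map_smul' := fun c G => ?_ } β⁻¹ hSn, hu⟩
  · refine ((hu _ _).1 ?_).symm
    rw [map_add J, ← hS G, ← hS G']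
    simp only [map_add]
    abel
  · refine ((hu _ _).1 ?_).symm
    rw [map_smul J, ← hS G]
    simp only [map_smul, RingHom.id_apply, smul_add]

end Abstract

/-! ### Compactness of the scalar Volterra operator -/

section CompactVolterra

/-- This modulus of continuity is uniform over bounded sets of `f`, so step approximations converge
in operator norm. -/
theorem norm_prim_sub_le {a : ℝ} (f : Lp ℝ 2 (leb a)) {s t : ℝ} (hst : s ≤ t) :
    ‖prim a f t - prim a f s‖ ≤ √(t - s) * ‖f‖ := by
  rw [prim_sub (Lp.integrable_leb f), intervalIntegral.integral_of_le hst]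
  refine (norm_setIntegral_le_sqrt_mul f measurableSet_Ioc).trans ?_
  gcongr
  rw [← Real.volume_real_Ioc_of_le hst]
  exact ENNReal.toReal_mono (by simp) (Measure.restrict_apply_le _ _)

/-- The approximation of the Volterra operator on `L²(0,a)` by step functions with values at the
nodes `ka/n`. -/
def volterraStep (a : ℝ) (n : ℕ) : Lp ℝ 2 (leb a) →L[ℝ] Lp ℝ 2 (leb a) :=
  ∑ k ∈ Finset.range n,
    (innerSL ℝ (indicatorConstLp 2 (μ := leb a) (measurableSet_Iic (a := a * k / n))
      (measure_ne_top _ _) (1 : ℝ))).smulRight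
      (indicatorConstLp 2 (μ := leb a) (measurableSet_Ico (a := a * k / n) (b := a * (k + 1) / n))
        (measure_ne_top _ _) (1 : ℝ))

theorem isCompactOperator_smulRight {X Y : Type*} [NormedAddCommGroup X] [NormedSpace ℝ X]
    [NormedAddCommGroup Y] [NormedSpace ℝ Y] (φ : X →L[ℝ] ℝ) (y : Y) :
    IsCompactOperator (φ.smulRight y) :=
  (isCompactOperator_of_locallyCompactSpace_dom φ).clm_comp (ContinuousLinearMap.toSpanSingleton ℝ y)

theorem isCompactOperator_volterraStep (a : ℝ) (n : ℕ) : IsCompactOperator (volterraStep a n) :=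
  Submodule.sum_mem (compactOperator (RingHom.id ℝ) (Lp ℝ 2 (leb a)) (Lp ℝ 2 (leb a)))
    fun _ _ => isCompactOperator_smulRight _ _

theorem coeFn_volterraStep {a : ℝ} {n : ℕ} (f : Lp ℝ 2 (leb a)) :
    volterraStep a n f =ᵐ[leb a] fun t => ∑ k ∈ Finset.range n,
      prim a f (a * k / n) * (Ico (a * k / n) (a * (k + 1) / n)).indicator (fun _ => (1 : ℝ)) t := by
  rw [volterraStep, _root_.sum_apply]
  refine (Lp.coeFn_finsetSum _ _).trans ?_
  have h : ∀ᵐ t ∂leb a, ∀ k ∈ Finset.range n, (((innerSL ℝ (indicatorConstLp 2 (μ := leb a)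
      (measurableSet_Iic (a := a * k / n)) (measure_ne_top _ _) (1 : ℝ))).smulRight
      (indicatorConstLp 2 (μ := leb a) (measurableSet_Ico (a := a * k / n) (b := a * (k + 1) / n))
        (measure_ne_top _ _) (1 : ℝ)) f : Lp ℝ 2 (leb a)) : ℝ → ℝ) t =
      prim a f (a * k / n) * (Ico (a * k / n) (a * (k + 1) / n)).indicator (fun _ => (1 : ℝ)) t := by
    rw [Finset.eventually_all]
    intro k _
    rw [ContinuousLinearMap.smulRight_apply, innerSL_apply_apply, L2.inner_indicatorConstLp_one]
    refine (Lp.coeFn_smul _ _).trans ?_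
    have h := indicatorConstLp_coeFn (μ := leb a) (p := 2) (c := (1 : ℝ))
      (hs := measurableSet_Ico (a := a * k / n) (b := a * (k + 1) / n)) (hμs := measure_ne_top _ _)
    refine h.mono fun t ht => ?_
    rw [Pi.smul_apply, ht, smul_eq_mul]
    rfl
  filter_upwards [h] with t ht
  rw [Finset.sum_apply]
  exact Finset.sum_congr rfl ht

/-- At each `t` the error is the increment of the primitive from the preceding node, at distance at
most `a / n`. The first factor converts a uniform bound into an `L²` bound. -/
theorem norm_volterra_sub_volterraStep_le {a : ℝ} (ha : 0 < a) {n : ℕ} (hn : 0 < n) :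
    ‖volterra ℝ a - volterraStep a n‖
      ≤ (measureUnivNNReal (leb a) : ℝ) ^ (2 : ENNReal).toReal⁻¹ * √(a / n) := by
  have hn' : (0 : ℝ) < n := Nat.cast_pos.2 hn
  refine ContinuousLinearMap.opNorm_le_bound _ (by positivity) fun f => ?_
  rw [mul_assoc]
  refine Lp.norm_le_of_ae_bound (by positivity) ?_
  rw [_root_.sub_apply]
  filter_upwards [Lp.coeFn_sub (volterra ℝ a f) (volterraStep a n f), coeFn_volterra f,
    coeFn_volterraStep (n := n) f, ae_restrict_mem measurableSet_Ioo] with t h1 h2 h3 ht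
  rw [h1, Pi.sub_apply, h2, h3]
  have hx : 0 ≤ n * t / a := by have := ht.1; positivity
  -- The index of the only cell containing `t`; all other summands vanish.
  set m := ⌊n * t / a⌋₊ with hm
  have hm1 : a * m / n ≤ t := by
    have := Nat.floor_le hx
    rw [le_div_iff₀ ha] at this
    rw [div_le_iff₀ hn']
    linarith
  have hm2 : t < a * (m + 1) / n := by
    have := Nat.lt_floor_add_one (n * t / a)
    rw [div_lt_iff₀ ha] at this
    rw [lt_div_iff₀ hn']
    linarith
  have hmn : m < n := by
    rw [hm, Nat.floor_lt hx, div_lt_iff₀ ha]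
    exact mul_lt_mul_of_pos_left ht.2 hn'
  rw [Finset.sum_eq_single m]
  · rw [indicator_of_mem (show t ∈ Ico (a * m / n) (a * (m + 1) / n) from ⟨hm1, hm2⟩), mul_one]
    refine (norm_prim_sub_le f hm1).trans ?_
    gcongr
    have : a * (m + 1) / n = a * m / n + a / n := by ring
    linarith
  · intro k _ hk
    rw [indicator_of_notMem, mul_zero]
    rintro ⟨hk1, hk2⟩
    apply hk
    rw [div_le_iff₀ hn'] at hk1
    rw [lt_div_iff₀ hn'] at hk2
    refine ((Nat.floor_eq_iff hx).2 ⟨?_, ?_⟩).symm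
    · rw [le_div_iff₀ ha]; linarith
    · rw [div_lt_iff₀ ha]; linarith
  · exact fun h => absurd (Finset.mem_range.2 hmn) h

theorem isCompactOperator_volterra {a : ℝ} (ha : 0 < a) : IsCompactOperator (volterra ℝ a) := by
  refine isCompactOperator_of_tendsto (l := atTop) (F := fun n : ℕ => volterraStep a n) ?_
    (Eventually.of_forall fun n => isCompactOperator_volterraStep a n)
  rw [tendsto_iff_norm_sub_tendsto_zero]
  have h : Tendsto (fun n : ℕ => (measureUnivNNReal (leb a) : ℝ) ^ (2 : ENNReal).toReal⁻¹ * √(a / n))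
      atTop (nhds 0) := by
    have h1 := (Real.continuous_sqrt.tendsto 0).comp (tendsto_const_div_atTop_nhds_zero_nat a)
    rw [Real.sqrt_zero] at h1
    simpa using h1.const_mul ((measureUnivNNReal (leb a) : ℝ) ^ (2 : ENNReal).toReal⁻¹)
  refine squeeze_zero' (Eventually.of_forall fun _ => norm_nonneg _) ?_ h
  filter_upwards [eventually_gt_atTop 0] with n hn
  rw [norm_sub_rev]
  exact norm_volterra_sub_volterraStep_le ha hn

end CompactVolterra

/-! ### Sobolev spaces, tip functionals and bilinear forms -/

section Sobolev

/-- A weak derivative and a zero value at the left end together say that a function is the primitive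
of its derivative. The space is thus cut out by continuous linear equations, which yields
completeness, the Poincaré inequality and the traces. -/
theorem mem_sobolevLeft_iff {k : ℕ} {a : ℝ} (ha : 0 < a)
    (p : PiLp 2 (fun _ : Fin (k + 1) => L2 a)) :
    p ∈ sobolevLeft k a ↔ ∀ i : Fin k, p i.castSucc = volterra ℝ a (p i.succ) := by
  refine forall_congr' fun i => ⟨fun h => ?_, fun h => ?_⟩
  · exact Lp.ext ((h.1.ae_eq_prim ha (Lp.integrable_leb _) (Lp.integrable_leb _) h.2).trans
      (coeFn_volterra _).symm)
  · have h' : (p i.castSucc : ℝ → ℝ) =ᵐ[leb a] prim a (p i.succ) := by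
      rw [h]; exact coeFn_volterra _
    refine ⟨isWeakDeriv_prim (Lp.integrable_leb _) h', ?_⟩
    have := hasValueAt_prim (Lp.integrable_leb _) h' 0
    rwa [prim_zero_right] at this

theorem isClosed_sobolevLeft {k : ℕ} {a : ℝ} (ha : 0 < a) :
    IsClosed (sobolevLeft k a : Set (PiLp 2 (fun _ : Fin (k + 1) => L2 a))) := by
  have : (sobolevLeft k a : Set (PiLp 2 (fun _ : Fin (k + 1) => L2 a)))
      = ⋂ i : Fin k, {p | p i.castSucc = volterra ℝ a (p i.succ)} := by
    ext p
    simp only [SetLike.mem_coe, mem_sobolevLeft_iff ha, mem_iInter, mem_ofPred_eq]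
  rw [this]
  refine isClosed_iInter fun i => isClosed_eq (PiLp.continuous_apply 2 _ _)
    ((volterra ℝ a).continuous.comp (PiLp.continuous_apply 2 _ _))

theorem completeSpace_sobolevLeft {k : ℕ} {a : ℝ} (ha : 0 < a) :
    CompleteSpace (sobolevLeft k a) :=
  (isClosed_sobolevLeft ha).completeSpace_coe

/-- The `i`-th derivative as an operator from the Sobolev space to `L²(0,a)`. -/
def sobolevComp (k : ℕ) (a : ℝ) (i : Fin (k + 1)) : sobolevLeft k a →L[ℝ] L2 a :=
  (PiLp.proj 2 (fun _ : Fin (k + 1) => L2 a) i : _ →L[ℝ] L2 a) ∘L (sobolevLeft k a).subtypeL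

theorem sobolevComp_castSucc {k : ℕ} {a : ℝ} (ha : 0 < a) (v : sobolevLeft k a) (i : Fin k) :
    sobolevComp k a i.castSucc v = volterra ℝ a (sobolevComp k a i.succ v) :=
  (mem_sobolevLeft_iff ha v.1).1 v.2 i

/-- The Poincaré inequality on `{v ∈ H²(0,a) : v(0) = v'(0) = 0}`. -/
theorem Deflection.norm_sq_le {ℓ : ℝ} (hℓ : 0 < ℓ) (v : Deflection ℓ) :
    ‖v‖ ^ 2 ≤ (‖volterra ℝ ℓ‖ ^ 4 + ‖volterra ℝ ℓ‖ ^ 2 + 1) * ‖sobolevComp 2 ℓ 2 v‖ ^ 2 := by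
  have h0 : ‖sobolevComp 2 ℓ 0 v‖ ≤ ‖volterra ℝ ℓ‖ * ‖sobolevComp 2 ℓ 1 v‖ := by
    have := sobolevComp_castSucc hℓ v 0
    exact (congrArg norm this).trans_le ((volterra ℝ ℓ).le_opNorm _)
  have h1 : ‖sobolevComp 2 ℓ 1 v‖ ≤ ‖volterra ℝ ℓ‖ * ‖sobolevComp 2 ℓ 2 v‖ := by
    have := sobolevComp_castSucc hℓ v 1
    exact (congrArg norm this).trans_le ((volterra ℝ ℓ).le_opNorm _)
  have h0' : ‖sobolevComp 2 ℓ 0 v‖ ≤ ‖volterra ℝ ℓ‖ ^ 2 * ‖sobolevComp 2 ℓ 2 v‖ := by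
    refine h0.trans ?_
    rw [pow_two, mul_assoc]
    gcongr
  have hn : ‖v‖ ^ 2 = ‖sobolevComp 2 ℓ 0 v‖ ^ 2 + ‖sobolevComp 2 ℓ 1 v‖ ^ 2
      + ‖sobolevComp 2 ℓ 2 v‖ ^ 2 := by
    rw [Submodule.coe_norm, PiLp.norm_sq_eq_of_L2, Fin.sum_univ_three]
    rfl
  have e0 := pow_le_pow_left₀ (norm_nonneg _) h0' 2
  have e1 := pow_le_pow_left₀ (norm_nonneg _) h1 2
  rw [hn]
  nlinarith

/-- The integral over `(0,a)` as a functional on `L²(0,a)`. -/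
def L2.integralCLM (a : ℝ) : L2 a →L[ℝ] ℝ :=
  innerSL ℝ (indicatorConstLp 2 (μ := leb a) MeasurableSet.univ (measure_ne_top _ _) (1 : ℝ))

theorem L2.integralCLM_apply {a : ℝ} (f : L2 a) : L2.integralCLM a f = ∫ x, f x ∂leb a := by
  rw [L2.integralCLM, innerSL_apply_apply, L2.inner_indicatorConstLp_one, Measure.restrict_univ]

theorem valueAt_volterra {a : ℝ} (ha : 0 < a) (f : L2 a) :
    valueAt a (volterra ℝ a f) a = L2.integralCLM a f := by
  rw [L2.integralCLM_apply, ← prim_end]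
  exact (hasValueAt_prim (Lp.integrable_leb f) (coeFn_volterra f) a).valueAt_eq ha ⟨ha.le, le_rfl⟩

/-- The tip deflection as a bounded functional. -/
def tipCLM (ℓ : ℝ) : Deflection ℓ →L[ℝ] ℝ := L2.integralCLM ℓ ∘L sobolevComp 2 ℓ 1

/-- The tip slope as a bounded functional. -/
def tipSlopeCLM (ℓ : ℝ) : Deflection ℓ →L[ℝ] ℝ := L2.integralCLM ℓ ∘L sobolevComp 2 ℓ 2

theorem tipCLM_apply {ℓ : ℝ} (hℓ : 0 < ℓ) (v : Deflection ℓ) : tipCLM ℓ v = v.tip := by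
  have := sobolevComp_castSucc hℓ v 0
  rw [Deflection.tip]
  change _ = valueAt ℓ (sobolevComp 2 ℓ (Fin.castSucc 0) v) ℓ
  rw [this, valueAt_volterra hℓ]
  rfl

theorem tipSlopeCLM_apply {ℓ : ℝ} (hℓ : 0 < ℓ) (v : Deflection ℓ) :
    tipSlopeCLM ℓ v = v.tipSlope := by
  have := sobolevComp_castSucc hℓ v 1
  rw [Deflection.tipSlope]
  change _ = valueAt ℓ (sobolevComp 2 ℓ (Fin.castSucc 1) v) ℓ
  rw [this, valueAt_volterra hℓ]
  rfl

/-- The operator on the Sobolev space that represents the form `∫ c v⁽ⁱ⁾ w⁽ⁱ⁾`. -/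
def formOp (k : ℕ) (a : ℝ) [CompleteSpace (sobolevLeft k a)] (i : Fin (k + 1))
    (c : Lp ℝ ⊤ (leb a)) : sobolevLeft k a →L[ℝ] sobolevLeft k a :=
  (sobolevComp k a i).adjoint ∘L
    (ContinuousLinearMap.mul ℝ ℝ).holderL (leb a) ⊤ 2 2 c ∘L sobolevComp k a i

section Form

variable {k : ℕ} {a : ℝ} {i : Fin (k + 1)} {c : ℝ → ℝ}

theorem integrable_form (hc : MemLp c ⊤ (leb a)) (v w : sobolevLeft k a) :
    Integrable (fun x => c x * sobolevComp k a i v x * sobolevComp k a i w x) (leb a) := by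
  have h : MemLp (fun x => c x * sobolevComp k a i v x) 2 (leb a) :=
    (Lp.memLp (sobolevComp k a i v)).mul hc
  exact h.integrable_mul (Lp.memLp (sobolevComp k a i w))

variable [CompleteSpace (sobolevLeft k a)]

theorem inner_formOp (hc : MemLp c ⊤ (leb a)) (v w : sobolevLeft k a) : ⟪formOp k a i (hc.toLp c) v, w⟫_ℝ
    = ∫ x, c x * sobolevComp k a i v x * sobolevComp k a i w x ∂leb a := by
  rw [formOp, ContinuousLinearMap.comp_apply, ContinuousLinearMap.comp_apply,
    ContinuousLinearMap.adjoint_inner_left, L2.inner_def]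
  refine integral_congr_ae ?_
  filter_upwards [(ContinuousLinearMap.mul ℝ ℝ).coeFn_holder (r := 2) (hc.toLp c)
    (sobolevComp k a i v), hc.coeFn_toLp] with x h1 h2
  change inner ℝ ((ContinuousLinearMap.mul ℝ ℝ).holder 2 (hc.toLp c) (sobolevComp k a i v) x) _ = _
  rw [h1, h2]
  simp [mul_comm]

theorem inner_formOp_symm (hc : MemLp c ⊤ (leb a)) (v w : sobolevLeft k a) :
    ⟪formOp k a i (hc.toLp c) v, w⟫_ℝ = ⟪v, formOp k a i (hc.toLp c) w⟫_ℝ := by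
  rw [inner_formOp, real_inner_comm, inner_formOp]
  simp only [mul_right_comm]

theorem le_inner_formOp (hc : MemLp c ⊤ (leb a)) {m : ℝ} (hm : ∀ᵐ x ∂leb a, m ≤ c x) (v : sobolevLeft k a) :
    m * ‖sobolevComp k a i v‖ ^ 2 ≤ ⟪formOp k a i (hc.toLp c) v, v⟫_ℝ := by
  rw [inner_formOp, ← real_inner_self_eq_norm_sq, L2.inner_def, ← integral_const_mul]
  refine integral_mono_ae ((L2.integrable_inner _ _).const_mul m) (integrable_form hc v v) ?_
  filter_upwards [hm] with x hx
  simp only [RCLike.inner_apply, conj_trivial, mul_assoc]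
  exact mul_le_mul_of_nonneg_right hx (mul_self_nonneg _)

end Form

end Sobolev

/-! ### The evolution equation in `L²(0,T;V)` -/

section Evolution

variable {V : Type*} [NormedAddCommGroup V] [InnerProductSpace ℝ V]

theorem le_inner_compLpL {α : Type*} [MeasurableSpace α] {μ : Measure α} {S : V →L[ℝ] V} {m : ℝ}
    (hS : ∀ v, m * ‖v‖ ^ 2 ≤ ⟪S v, v⟫_ℝ) (f : Lp V 2 μ) :
    m * ‖f‖ ^ 2 ≤ ⟪S.compLpL 2 μ f, f⟫_ℝ := by
  rw [← real_inner_self_eq_norm_sq, L2.inner_def, L2.inner_def, ← integral_const_mul]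
  refine integral_mono_ae ((L2.integrable_inner _ _).const_mul m) (L2.integrable_inner _ _) ?_
  filter_upwards [S.coeFn_compLpL f] with x hx
  rw [hx, real_inner_self_eq_norm_sq]
  exact hS _

theorem inner_compLpL_symm {α : Type*} [MeasurableSpace α] {μ : Measure α} {S : V →L[ℝ] V}
    (hS : ∀ v w, ⟪S v, w⟫_ℝ = ⟪v, S w⟫_ℝ) (f g : Lp V 2 μ) :
    ⟪S.compLpL 2 μ f, g⟫_ℝ = ⟪f, S.compLpL 2 μ g⟫_ℝ := by
  rw [L2.inner_def, L2.inner_def]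
  refine integral_congr_ae ?_
  filter_upwards [S.coeFn_compLpL f, S.coeFn_compLpL g] with x h1 h2
  rw [h1, h2, hS]

/-- The operator `w ↦ C w + R ∫₀ᵗ w` on `L²(0,T;V)`. -/
def memoryOp (T : ℝ) (C R : V →L[ℝ] V) : Lp V 2 (leb T) →L[ℝ] Lp V 2 (leb T) :=
  C.compLpL 2 (leb T) + R.compLpL 2 (leb T) ∘L volterra V T

theorem coeFn_memoryOp {T : ℝ} {C R : V →L[ℝ] V} (w : Lp V 2 (leb T)) :
    memoryOp T C R w =ᵐ[leb T] fun t => C (w t) + R (prim T w t) := by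
  rw [memoryOp]
  filter_upwards [Lp.coeFn_add (C.compLpL 2 (leb T) w) (R.compLpL 2 (leb T) (volterra V T w)),
    C.coeFn_compLpL w, R.coeFn_compLpL (volterra V T w), coeFn_volterra w] with t h1 h2 h3 h4
  change (C.compLpL 2 (leb T) w + R.compLpL 2 (leb T) (volterra V T w) : Lp V 2 (leb T)) t = _
  rw [h1, Pi.add_apply, h2, h3, h4]

/-- The abstract evolution equation `(M w)' + C w + R ∫₀ᵗ w = G`, `(M w)(0) = 0`, in integrated
form, is solved by a bounded linear operator `G ↦ w` on `L²(0,T;V)`. -/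
theorem exists_evolution_operator [CompleteSpace V] (T : ℝ) {M C R : V →L[ℝ] V} {β : ℝ}
    (hβ : 0 < β) (hM : ∀ v w, ⟪M v, w⟫_ℝ = ⟪v, M w⟫_ℝ) (hM0 : ∀ v, 0 ≤ ⟪M v, v⟫_ℝ)
    (hR : ∀ v w, ⟪R v, w⟫_ℝ = ⟪v, R w⟫_ℝ) (hR0 : ∀ v, 0 ≤ ⟪R v, v⟫_ℝ)
    (hC : ∀ v, β * ‖v‖ ^ 2 ≤ ⟪C v, v⟫_ℝ) :
    ∃ S : Lp V 2 (leb T) →L[ℝ] Lp V 2 (leb T), ∀ G w,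
      M.compLpL 2 (leb T) w + volterra V T (memoryOp T C R w) = volterra V T G ↔ w = S G := by
  refine exists_solution_operator hβ (inner_compLpL_symm hM) (volterra_compLpL M) (fun w => ?_)
    volterra_injective (inner_volterra_nonneg M hM hM0) (fun w => ?_)
  · simp only [memoryOp, _root_.add_apply, ContinuousLinearMap.comp_apply, map_add,
      volterra_compLpL]
  -- Symmetry of `R` turns the memory term `⟪R J w, w⟫` into the nonnegative `⟪R w, J w⟫`, so the
  -- coercivity constant of `C` survives.
  · have h1 := le_inner_compLpL hC w
    have h2 := inner_volterra_nonneg R hR hR0 w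
    rw [memoryOp, _root_.add_apply, ContinuousLinearMap.comp_apply, inner_add_left,
      inner_compLpL_symm hR, real_inner_comm _ (volterra V T w)]
    linarith

/-- The exceptional null set may depend on `v`; almost separable range of a strongly measurable
function makes it uniform. -/
theorem Lp.eq_of_forall_inner {α : Type*} [MeasurableSpace α] {μ : Measure α} [CompleteSpace V]
    {f g : Lp V 2 μ} (h : ∀ v, (fun t => ⟪f t, v⟫_ℝ) =ᵐ[μ] fun t => ⟪g t, v⟫_ℝ) : f = g := by
  obtain ⟨s, hs, hfs⟩ := (Lp.aestronglyMeasurable (f - g)).isSeparable_ae_range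
  rw [← sub_eq_zero]
  refine Lp.ext (EventuallyEq.trans ?_ (Lp.coeFn_zero _ _ _).symm)
  refine ae_eq_zero_of_forall_dual_of_isSeparable ℝ hs (fun c => ?_) hfs
  filter_upwards [h ((InnerProductSpace.toDual ℝ V).symm c), Lp.coeFn_sub f g] with t h1 h2
  rw [real_inner_comm, InnerProductSpace.toDual_symm_apply, real_inner_comm,
    InnerProductSpace.toDual_symm_apply] at h1
  rw [h2, Pi.sub_apply, map_sub, h1, sub_self, Pi.zero_apply]

theorem memLp_toDual_symm {α : Type*} [MeasurableSpace α] {μ : Measure α} [CompleteSpace V]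
    {z : α → V →L[ℝ] ℝ} (hz : MemLp z 2 μ) :
    MemLp (fun t => (InnerProductSpace.toDual ℝ V).symm (z t)) 2 μ :=
  (InnerProductSpace.toDual ℝ V).symm.lipschitz.comp_memLp (LinearIsometryEquiv.map_zero _) hz

theorem memLp_toDual {α : Type*} [MeasurableSpace α] {μ : Measure α} [CompleteSpace V]
    {ζ : α → V} (hζ : MemLp ζ 2 μ) :
    MemLp (fun t => InnerProductSpace.toDual ℝ V (ζ t)) 2 μ :=
  (InnerProductSpace.toDual ℝ V).lipschitz.comp_memLp (LinearIsometryEquiv.map_zero _) hζ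

/-- For each `v` the scalar statement is an identity of primitives, and `⟪·, v⟫` passes through the
integral. This trades the family of scalar conditions for one identity of vector-valued functions.
-/
theorem isWeakDeriv_inner_iff [CompleteSpace V] {T : ℝ} (hT : 0 < T) (S : V →L[ℝ] V)
    {w ζ : ℝ → V} (hw : MemLp w 2 (leb T)) (hζ : MemLp ζ 2 (leb T)) :
    (∀ v, IsWeakDeriv T (fun t => ⟪S (w t), v⟫_ℝ) (fun t => ⟪ζ t, v⟫_ℝ) ∧
      HasValueAt T (fun t => ⟪S (w t), v⟫_ℝ) 0 0) ↔
    S.compLpL 2 (leb T) (hw.toLp w) = volterra V T (hζ.toLp ζ) := by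
  have hwi : Integrable w (leb T) := hw.integrable (by norm_num)
  have hζi : Integrable ζ (leb T) := hζ.integrable (by norm_num)
  have hφ : ∀ v y : V, ⟪y, v⟫_ℝ = innerSL ℝ v y := fun v y => real_inner_comm _ _
  simp only [hφ]
  constructor
  · refine fun h => Lp.eq_of_forall_inner fun v => ?_
    simp only [hφ]
    have h2 := (h v).1.ae_eq_prim hT ((innerSL ℝ v ∘L S).integrable_comp hwi)
      ((innerSL ℝ v).integrable_comp hζi) (h v).2
    filter_upwards [h2, S.coeFn_compLpL (hw.toLp w), hw.coeFn_toLp, coeFn_volterra (hζ.toLp ζ)]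
      with t h2 h3 h4 h5
    rw [h3, h4, h5, prim_congr hζ.coeFn_toLp, ← map_prim (innerSL ℝ v) hζi]
    exact h2
  · intro h v
    have h' : (fun t => innerSL ℝ v (S (w t))) =ᵐ[leb T] prim T fun t => innerSL ℝ v (ζ t) := by
      filter_upwards [S.coeFn_compLpL (hw.toLp w), hw.coeFn_toLp, coeFn_volterra (hζ.toLp ζ)]
        with t h1 h2 h3
      rw [map_prim (innerSL ℝ v) hζi, ← prim_congr hζ.coeFn_toLp, ← h3, ← h, h1, h2]
    refine ⟨isWeakDeriv_prim ((innerSL ℝ v).integrable_comp hζi) h', ?_⟩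
    have := hasValueAt_prim ((innerSL ℝ v).integrable_comp hζi) h' 0
    rwa [prim_zero_right] at this

end Evolution

/-! ### Weak solutions of the beam equation -/

section WeakSolution

theorem memLp_top_of_bounds {a : ℝ} {c : ℝ → ℝ} (hm : AEStronglyMeasurable c (leb a)) {c₀ c₁ : ℝ}
    (h : ∀ᵐ x ∂leb a, c₀ ≤ c x ∧ c x ≤ c₁) : MemLp c ⊤ (leb a) :=
  memLp_top_of_bound hm (max |c₀| |c₁|) (h.mono fun _ hx => abs_le_max_abs_abs hx.1 hx.2)

/-- All four coefficients of the beam are essentially bounded. -/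
structure Beam.BoundedCoefficients (B : Beam) : Prop where
  ρ : MemLp B.ρ ⊤ (leb B.ℓ)
  μ : MemLp B.μ ⊤ (leb B.ℓ)
  r : MemLp B.r ⊤ (leb B.ℓ)
  κ : MemLp B.κ ⊤ (leb B.ℓ)

theorem Beam.BasicConditions.boundedCoefficients {B : Beam} (hB : B.BasicConditions) :
    B.BoundedCoefficients := by
  obtain ⟨_, _, _, h1⟩ := hB.ρ_bounds
  obtain ⟨_, _, _, h2⟩ := hB.μ_bounds
  obtain ⟨_, _, _, h3⟩ := hB.r_bounds
  obtain ⟨_, _, _, h4⟩ := hB.κ_bounds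
  exact ⟨memLp_top_of_bounds hB.ρ_meas h1, memLp_top_of_bounds hB.μ_meas h2,
    memLp_top_of_bounds hB.r_meas h3, memLp_top_of_bounds hB.κ_meas h4⟩

namespace Beam.BoundedCoefficients

variable {B : Beam} [CompleteSpace (Deflection B.ℓ)] (hc : B.BoundedCoefficients)

/-- The mass operator, `⟪M v, w⟫ = ∫ ρ v w`. -/
def massOp : Deflection B.ℓ →L[ℝ] Deflection B.ℓ := formOp 2 B.ℓ 0 (hc.ρ.toLp _)

/-- The damping operator, `⟪C v, w⟫ = ∫ μ v w + ∫ κ v'' w''`. -/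
def dampingOp : Deflection B.ℓ →L[ℝ] Deflection B.ℓ :=
  formOp 2 B.ℓ 0 (hc.μ.toLp _) + formOp 2 B.ℓ 2 (hc.κ.toLp _)

/-- The stiffness operator, `⟪R v, w⟫ = ∫ r v'' w''`. -/
def stiffnessOp : Deflection B.ℓ →L[ℝ] Deflection B.ℓ := formOp 2 B.ℓ 2 (hc.r.toLp _)

variable (B) in
/-- The Riesz representative of the load functional `v ↦ v(ℓ) + (2 h cos θ / π) v'(ℓ)`. -/
def _root_.Beam.loadVector : Deflection B.ℓ :=
  (InnerProductSpace.toDual ℝ (Deflection B.ℓ)).symm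
    (tipCLM B.ℓ + (2 * B.h * Real.cos B.θ / Real.pi) • tipSlopeCLM B.ℓ)

theorem inner_massOp (v w : Deflection B.ℓ) :
    ⟪hc.massOp v, w⟫_ℝ = ∫ x in Ioo 0 B.ℓ, B.ρ x * v.toFun x * w.toFun x :=
  inner_formOp hc.ρ v w

theorem inner_loadVector (hℓ : 0 < B.ℓ) (v : Deflection B.ℓ) :
    ⟪B.loadVector, v⟫_ℝ = v.tip + (2 * B.h * Real.cos B.θ / Real.pi) * v.tipSlope := by
  rw [Beam.loadVector, InnerProductSpace.toDual_symm_apply, ← tipCLM_apply hℓ,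
    ← tipSlopeCLM_apply hℓ]
  rfl

/-- The variational equation at a fixed time as an equation between vectors. -/
theorem balance_iff (hℓ : 0 < B.ℓ) (ζ u w : Deflection B.ℓ) (g : ℝ) :
    (∀ v : Deflection B.ℓ, ⟪ζ, v⟫_ℝ + (∫ x in Ioo 0 B.ℓ, B.μ x * w.toFun x * v.toFun x)
        + (∫ x in Ioo 0 B.ℓ, (B.r x * u.dxx x + B.κ x * w.dxx x) * v.dxx x)
      = g * v.tip + (2 * B.h * Real.cos B.θ / Real.pi * g) * v.tipSlope) ↔
    ζ + (hc.dampingOp w + hc.stiffnessOp u) = g • B.loadVector := by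
  have key : ∀ v : Deflection B.ℓ, ⟪ζ + (hc.dampingOp w + hc.stiffnessOp u), v⟫_ℝ
      = ⟪ζ, v⟫_ℝ + (∫ x in Ioo 0 B.ℓ, B.μ x * w.toFun x * v.toFun x)
        + (∫ x in Ioo 0 B.ℓ, (B.r x * u.dxx x + B.κ x * w.dxx x) * v.dxx x) := by
    intro v
    have h1 : ∫ x in Ioo 0 B.ℓ, (B.r x * u.dxx x + B.κ x * w.dxx x) * v.dxx x
        = (∫ x in Ioo 0 B.ℓ, B.r x * u.dxx x * v.dxx x)
          + ∫ x in Ioo 0 B.ℓ, B.κ x * w.dxx x * v.dxx x := by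
      simp only [add_mul]
      exact integral_add (integrable_form hc.r u v) (integrable_form hc.κ w v)
    have h2 : ⟪formOp 2 B.ℓ 0 (hc.μ.toLp _) w, v⟫_ℝ
      = ∫ x in Ioo 0 B.ℓ, B.μ x * w.toFun x * v.toFun x := inner_formOp hc.μ w v
    have h3 : ⟪formOp 2 B.ℓ 2 (hc.κ.toLp _) w, v⟫_ℝ
      = ∫ x in Ioo 0 B.ℓ, B.κ x * w.dxx x * v.dxx x := inner_formOp hc.κ w v
    have h4 : ⟪formOp 2 B.ℓ 2 (hc.r.toLp _) u, v⟫_ℝ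
      = ∫ x in Ioo 0 B.ℓ, B.r x * u.dxx x * v.dxx x := inner_formOp hc.r u v
    rw [h1, ← h2, ← h3, ← h4, dampingOp, stiffnessOp]
    simp only [inner_add_left, _root_.add_apply]
    ring
  have key' : ∀ v : Deflection B.ℓ, ⟪g • B.loadVector, v⟫_ℝ
      = g * v.tip + (2 * B.h * Real.cos B.θ / Real.pi * g) * v.tipSlope := by
    intro v
    refine (real_inner_smul_left B.loadVector v g).trans ?_
    rw [inner_loadVector hℓ]
    ring
  simp only [← key, ← key']
  exact ⟨fun h => ext_inner_right ℝ h, fun h v => by rw [h]⟩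

/-- The load `t ↦ g(t) L` in `L²(0,T;V)`, where `L` is the load vector. -/
def load (B : Beam) [CompleteSpace (Deflection B.ℓ)] :
    L2 B.T →L[ℝ] Lp (Deflection B.ℓ) 2 (leb B.T) :=
  (ContinuousLinearMap.toSpanSingleton ℝ B.loadVector).compLpL 2 (leb B.T)

theorem coeFn_load (g : L2 B.T) : load B g =ᵐ[leb B.T] fun t => g t • B.loadVector :=
  (ContinuousLinearMap.toSpanSingleton ℝ B.loadVector).coeFn_compLpL g

/-- Weak solutions are the primitives of the solutions of the evolution equation. -/
theorem isWeakSolution_iff (hℓ : 0 < B.ℓ) (hT : 0 < B.T) (g : L2 B.T)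
    (u : ℝ → Deflection B.ℓ) :
    B.IsWeakSolution g u ↔ ∃ w : Lp (Deflection B.ℓ) 2 (leb B.T), u =ᵐ[leb B.T] prim B.T w ∧
      hc.massOp.compLpL 2 (leb B.T) w
        + volterra _ B.T (memoryOp B.T hc.dampingOp hc.stiffnessOp w)
        = volterra _ B.T (load B g) := by
  constructor
  · rintro ⟨hu, hu0, w, z, hw, hz, huw, hwz, heq⟩
    have hwi : Integrable w (leb B.T) := hw.integrable (by norm_num)
    have huprim : u =ᵐ[leb B.T] prim B.T w := by
      -- The weak derivative in time is stated in the ambient product of `L²` spaces; the primitive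
      -- taken there is the image under `ι` of the one taken in `V`.
      let ι := (sobolevLeft 2 B.ℓ).subtypeL
      have h0 : HasValueAt B.T (fun t => (u t).1) 0 0 := by
        obtain ⟨U, hU, huU, hU0⟩ := hu0
        refine ⟨fun t => (U t).1, ι.continuous.comp_continuousOn hU,
          huU.mono fun t ht => congrArg Subtype.val ht, congrArg Subtype.val hU0⟩
      have h1 := huw.ae_eq_prim hT (ι.integrable_comp (hu.integrable (by norm_num)))
        (ι.integrable_comp hwi) h0
      filter_upwards [h1] with t ht
      exact Subtype.ext (ht.trans (map_prim ι hwi t))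
    have hζ := memLp_toDual_symm hz
    have hzζ : ∀ t v, z t v = ⟪(InnerProductSpace.toDual ℝ (Deflection B.ℓ)).symm (z t), v⟫_ℝ :=
      fun t v => InnerProductSpace.toDual_symm_apply.symm
    set ζ := fun t => (InnerProductSpace.toDual ℝ (Deflection B.ℓ)).symm (z t)
    refine ⟨hw.toLp w, huprim.trans (prim_congr hw.coeFn_toLp ▸ ae_eq_refl _), ?_⟩
    have hmass : hc.massOp.compLpL 2 (leb B.T) (hw.toLp w) = volterra _ B.T (hζ.toLp ζ) := by
      refine (isWeakDeriv_inner_iff hT hc.massOp hw hζ).1 fun v => ?_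
      simp only [inner_massOp, ζ, ← hzζ]
      exact hwz v
    have hbal : hζ.toLp ζ + memoryOp B.T hc.dampingOp hc.stiffnessOp (hw.toLp w) = load B g := by
      refine Lp.ext ?_
      filter_upwards [Lp.coeFn_add (hζ.toLp ζ) (memoryOp B.T hc.dampingOp hc.stiffnessOp
        (hw.toLp w)), hζ.coeFn_toLp, hw.coeFn_toLp, coeFn_load g, huprim, heq,
        coeFn_memoryOp (C := hc.dampingOp) (R := hc.stiffnessOp) (hw.toLp w)]
        with t h1 h2 h3 h4 h5 h6 h7
      rw [h1, Pi.add_apply, h2, h4, h7, h3, prim_congr hw.coeFn_toLp, ← h5]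
      simp only [hzζ] at h6
      exact (hc.balance_iff hℓ _ _ _ _).1 h6
    rw [hmass, ← hbal, map_add]
  · rintro ⟨w, huw, heq⟩
    have hwi := Lp.integrable_leb w
    -- Defining `(ρ u_t)_t` by the balance of forces makes the variational equation automatic; the
    -- integrated equation then says that `ζ` is its time derivative.
    let ζ := load B g - memoryOp B.T hc.dampingOp hc.stiffnessOp w
    have hmass : hc.massOp.compLpL 2 (leb B.T) w = volterra _ B.T ζ := by
      rw [map_sub, ← heq, add_sub_cancel_right]
    have hder := (isWeakDeriv_inner_iff hT hc.massOp (Lp.memLp w) (Lp.memLp ζ)).2 (by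
      rwa [Lp.toLp_coeFn, Lp.toLp_coeFn])
    simp only [inner_massOp] at hder
    refine ⟨(memLp_prim w).ae_eq huw.symm, ?_, w,
      fun t => InnerProductSpace.toDual ℝ _ (ζ t), Lp.memLp w,
      memLp_toDual (Lp.memLp ζ), ?_, hder, ?_⟩
    · have := hasValueAt_prim hwi huw 0
      rwa [prim_zero_right] at this
    · let ι := (sobolevLeft 2 B.ℓ).subtypeL
      refine isWeakDeriv_prim (ι.integrable_comp hwi) ?_
      filter_upwards [huw] with t ht
      exact (congrArg ι ht).trans (map_prim ι hwi t).symm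
    · filter_upwards [Lp.coeFn_sub (load B g) (memoryOp B.T hc.dampingOp hc.stiffnessOp w),
        coeFn_load g, coeFn_memoryOp (C := hc.dampingOp) (R := hc.stiffnessOp) w, huw]
        with t h1 h2 h3 h4
      simp only [InnerProductSpace.toDual_apply_apply]
      rw [hc.balance_iff hℓ]
      rw [h1, Pi.sub_apply, h2, h3, h4, sub_add_cancel]

end Beam.BoundedCoefficients

/-- The weak solutions are the primitives of `S (g L)`, where `S` is a bounded operator on
`L²(0,T;V)` and `L` is the load vector. -/
theorem Beam.BasicConditions.exists_velocity_operator {B : Beam} (hB : B.BasicConditions)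
    [CompleteSpace (Deflection B.ℓ)] :
    ∃ S : Lp (Deflection B.ℓ) 2 (leb B.T) →L[ℝ] Lp (Deflection B.ℓ) 2 (leb B.T),
      ∀ (g : L2 B.T) (u : ℝ → Deflection B.ℓ), B.IsWeakSolution g u ↔
        u =ᵐ[leb B.T] prim B.T (S (BoundedCoefficients.load B g)) := by
  have hc := hB.boundedCoefficients
  obtain ⟨ρ₀, _, hρ₀, hρ⟩ := hB.ρ_bounds
  obtain ⟨μ₀, _, hμ₀, hμ⟩ := hB.μ_bounds
  obtain ⟨r₀, _, hr₀, hr⟩ := hB.r_bounds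
  obtain ⟨κ₀, _, hκ₀, hκ⟩ := hB.κ_bounds
  have hP := Deflection.norm_sq_le hB.ℓ_pos
  set P := ‖volterra ℝ B.ℓ‖ ^ 4 + ‖volterra ℝ B.ℓ‖ ^ 2 + 1
  have hP0 : 0 < P := by positivity
  -- The constant `κ₀ / P` is the Kelvin-Voigt bound on `v''` divided by the Poincaré constant; the
  -- external damping only adds a nonnegative term.
  obtain ⟨S, hS⟩ := exists_evolution_operator B.T (M := hc.massOp) (C := hc.dampingOp)
    (R := hc.stiffnessOp) (β := κ₀ / P) (by positivity) (inner_formOp_symm hc.ρ)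
    (fun v => le_trans (by positivity) (le_inner_formOp hc.ρ (hρ.mono fun _ h => h.1) v))
    (inner_formOp_symm hc.r)
    (fun v => le_trans (by positivity) (le_inner_formOp hc.r (hr.mono fun _ h => h.1) v))
    (fun v => by
      have h1 := le_inner_formOp (i := 0) hc.μ (hμ.mono fun _ h => h.1) v
      have h2 := le_inner_formOp (i := 2) hc.κ (hκ.mono fun _ h => h.1) v
      have h3 : 0 ≤ μ₀ * ‖sobolevComp 2 B.ℓ 0 v‖ ^ 2 := by positivity
      rw [BoundedCoefficients.dampingOp, _root_.add_apply, inner_add_left]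
      have h4 : κ₀ / P * ‖v‖ ^ 2 ≤ κ₀ * ‖sobolevComp 2 B.ℓ 2 v‖ ^ 2 := by
        rw [div_mul_eq_mul_div, div_le_iff₀ hP0, mul_assoc]
        refine mul_le_mul_of_nonneg_left ((hP v).trans_eq (mul_comm _ _)) hκ₀.le
      linarith)
  refine ⟨S, fun g u => ?_⟩
  rw [hc.isWeakSolution_iff hB.ℓ_pos hB.T_pos]
  constructor
  · rintro ⟨w, huw, hw⟩
    rwa [← (hS _ _).1 hw]
  · exact fun h => ⟨_, h, (hS _ _).2 rfl⟩

end WeakSolution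

end

/-! ### The Neumann-to-Dirichlet operator -/

theorem lemma1 (B : Beam) (hB : B.BasicConditions) :
    (∀ g : ShearForce B.T, ∃ u : ℝ → Deflection B.ℓ,
      B.IsWeakSolution g.toFun u ∧
      (∀ u' : ℝ → Deflection B.ℓ, B.IsWeakSolution g.toFun u' →
        u' =ᵐ[volume.restrict (Ioo 0 B.T)] u) ∧
      B.neumannToDirichlet g =ᵐ[volume.restrict (Ioo 0 B.T)] fun t => (u t).tip) ∧
    IsLinearMap ℝ B.neumannToDirichlet ∧
    IsCompactOperator B.neumannToDirichlet ∧
    ∀ C : ℝ, 0 < C → IsCompact (closure (B.neumannToDirichlet '' admissibleSet B.T C)) := by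
  have : CompleteSpace (Deflection B.ℓ) := completeSpace_sobolevLeft hB.ℓ_pos
  obtain ⟨S, hS⟩ := hB.exists_velocity_operator
  let Q : L2 B.T →L[ℝ] L2 B.T := (tipCLM B.ℓ).compLpL 2 (leb B.T) ∘L volterra _ B.T ∘L S ∘L
    Beam.BoundedCoefficients.load B
  let Ψ : ShearForce B.T →L[ℝ] L2 B.T := Q ∘L sobolevComp 1 B.T 0
  have hout : ∀ (g : ShearForce B.T) (u : ℝ → Deflection B.ℓ), B.IsWeakSolution g.toFun u →
      Ψ g =ᵐ[leb B.T] fun t => (u t).tip := by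
    intro g u hu
    have h1 := (hS (sobolevComp 1 B.T 0 g) u).1 hu
    filter_upwards [h1, (tipCLM B.ℓ).coeFn_compLpL (volterra _ B.T (S
      (Beam.BoundedCoefficients.load B (sobolevComp 1 B.T 0 g)))),
      coeFn_volterra (S (Beam.BoundedCoefficients.load B (sobolevComp 1 B.T 0 g)))] with t h1 h2 h3
    rw [h1, ← h3, ← tipCLM_apply hB.ℓ_pos, ← h2]
    rfl
  have hsol : ∀ g : ShearForce B.T, B.IsWeakSolution g.toFun (prim B.T
      (S (Beam.BoundedCoefficients.load B (sobolevComp 1 B.T 0 g)))) := fun g =>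
    (hS (sobolevComp 1 B.T 0 g) _).2 (ae_eq_refl _)
  have hΨ : B.neumannToDirichlet = Ψ := by
    funext g
    -- An output exists, so the default value `0` is not taken, and `hout` forces whichever output
    -- is chosen to be `Ψ g`.
    have h : ∃ y, B.IsOutput g y := ⟨Ψ g, _, hsol g, hout g _ (hsol g)⟩
    rw [Beam.neumannToDirichlet, dif_pos h]
    obtain ⟨u, hu, hy⟩ := h.choose_spec
    exact Lp.ext (hy.trans (hout g u hu).symm)
  have hcompact : IsCompactOperator Ψ := by
    -- Here `g(0) = 0` enters: `g` is the Volterra image of its derivative, which is bounded in `L²`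
    -- by the `H¹` norm.
    have h : Ψ = (Q ∘L volterra ℝ B.T) ∘L sobolevComp 1 B.T 1 := by
      ext1 g
      exact congrArg Q (sobolevComp_castSucc hB.T_pos g 0)
    rw [h]
    exact ((isCompactOperator_volterra hB.T_pos).clm_comp Q).comp_clm (sobolevComp 1 B.T 1)
  rw [hΨ]
  refine ⟨fun g => ⟨_, hsol g, fun u' hu' => (hS (sobolevComp 1 B.T 0 g) u').1 hu',
    hout g _ (hsol g)⟩, Ψ.toLinearMap.isLinear, hcompact, fun C _ => ?_⟩
  refine IsCompactOperator.isCompact_closure_image_of_bounded (f := Ψ.toLinearMap) hcompact ?_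
  exact (Metric.isBounded_closedBall (x := (0 : ShearForce B.T)) (r := C)).subset
    fun g hg => mem_closedBall_zero_iff.2 hg
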